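/- An integer-valued random variable $X$ with probability mass function $p(j)=\mathbb{P}(X=j)$ is called discrete log-concave if $p(j)^2\ge p(j-1)\,p(j+1)$ for all $j\in\mathbb{Z}$ and its support $\{j\in\mathbb{Z}: p(j)>0\}$ is an integer interval; it is finitely supported if this support is finite. It is symmetric about a point if there is $m\in\mathbb{R}$ such that $X-m$ and $m-X$ have the same distribution. **Theorem.** Let $n\ge 1$ and let $X_1,\dots,X_n$ be independent, finitely supported, discrete log-concave (integer-valued) random variables. Then $$\sup_{a\in(\mathbb{R}\setminus\{0\})^n}\ \sup_{x\in\mathbb{R}}\ \mathbb{P}(a_1X_1+\cdots+a_nX_n=x)\ \le\ \frac{1}{\sqrt{1+c\sum_{k=1}^n \operatorname{Var}(X_k)}}$$ with $c=1$. Moreover, if in addition each $X_k$ is symmetric about a point (which may depend on $k$), then the inequality holds with $c=2$. -/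

import Mathlib

open MeasureTheory ProbabilityTheory

noncomputable section

/-- The probability mass function `j ↦ P(X = j)` of an integer-valued random variable. -/
def massFn {Ω : Type*} [MeasurableSpace Ω] (X : Ω → ℤ) (P : Measure Ω) (j : ℤ) : ℝ :=
  P.real {ω | X ω = j}

/-- `X` is discrete log-concave: its probability mass function `p` satisfies
`p(j)² ≥ p(j-1) p(j+1)` for all integers `j`, and its support is an integer interval. -/
structure IsDiscreteLogConcave {Ω : Type*} [MeasurableSpace Ω] (X : Ω → ℤ) (P : Measure Ω) :
    Prop where
  mul_le_sq : ∀ j : ℤ, massFn X P (j - 1) * massFn X P (j + 1) ≤ massFn X P j ^ 2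
  support_interval : (Function.support (massFn X P)).OrdConnected

/-- `X` is finitely supported: only finitely many integers have positive probability. -/
def IsFinitelySupported {Ω : Type*} [MeasurableSpace Ω] (X : Ω → ℤ) (P : Measure Ω) : Prop :=
  (Function.support (massFn X P)).Finite

/-- The law of `X` is symmetric about some real point `m`: `X - m` and `m - X` have the
same distribution. -/
def IsSymmetricAboutPoint {Ω : Type*} [MeasurableSpace Ω] (X : Ω → ℤ) (P : Measure Ω) : Prop :=
  ∃ m : ℝ, IdentDistrib (fun ω => (X ω : ℝ) - m) (fun ω => m - (X ω : ℝ)) P P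

end

/-! Replace `X k` by `-X k` wherever `a k < 0`; log-concavity, variance and symmetry survive, and
the coefficients become `|a k| > 0`. Let `S` be the plain sum of these variables, `T` the weighted
sum, and `W` the mass function of `S`.

The heart is a comparison of `T` with `S`: `P(T ≥ c | S = j) ≤ P(T > c | S = j + 1)`
(`IsRankMonotone`), proved by adding one variable `X` at a time (`IsRankMonotone.add`). By
log-concavity, `X` given that the new sum is `j` can be coupled with `X` given that it is `j + 1` so
that it rises by 0 or 1 (`sum_mul_sum_le_of_monotone_ratio`). If `X` stays, the old sum rises by 1
and induction applies; if `X` rises, the old sum stays and `T` gains a positive coefficient.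
Consequently the numbers `P(T = x | S = j)` telescope over `j` to at most 1, whence `P(T = x) ≤ max
W` (`IsRankMonotone.measureReal_snd_eq_le`).

It remains to bound `M = max W`. `S` is log-concave, as a convolution, and its variance is the sum
of the variances. Each side of a point is submultiplicative, which bounds its first two moments by
those of a geometric sequence; combining both sides gives `M² (1 + Var S) ≤ 1`, and `M² (1 + 2 Var
S) ≤ 1` under symmetry. -/

/-! ### Log-concave sequences and their convolution -/

/-- A Pólya frequency sequence of order two: nonnegative, log-concave, without internal zeros. -/
structure IsPF2 (a : ℤ → ℝ) : Prop where
  nonneg : ∀ j, 0 ≤ a j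
  mul_le_mul : ∀ s t, s ≤ t → a s * a (t + 1) ≤ a (s + 1) * a t

namespace IsPF2

variable {a b : ℤ → ℝ}

theorem of_logConcave (h0 : ∀ j, 0 ≤ a j) (h1 : ∀ j, a (j - 1) * a (j + 1) ≤ a j ^ 2)
    (h2 : (Function.support a).OrdConnected) : IsPF2 a := by
  have key : ∀ (d : ℕ) (s : ℤ), a s * a (s + d + 1) ≤ a (s + 1) * a (s + d) := by
    intro d s
    induction d with
    | zero => simp [mul_comm]
    | succ d ih =>
      have hpos : ∀ t, a t ≠ 0 → 0 < a t := fun t ht => lt_of_le_of_ne (h0 t) ht.symm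
      have e : s + ((d + 1 : ℕ) : ℤ) = s + d + 1 := by push_cast; ring
      rw [e]
      have hR : 0 ≤ a (s + 1) * a (s + d + 1) := mul_nonneg (h0 _) (h0 _)
      by_cases hs : a s = 0
      · simpa [hs] using hR
      by_cases hz : a (s + d + 1 + 1) = 0
      · simpa [hz] using hR
      -- The induction cancels the factor `a (s + d)`; the absence of internal zeros makes it
      -- positive.
      have hd : a (s + d) ≠ 0 := h2.out hs hz ⟨by lia, by lia⟩
      have hl := h1 (s + d + 1)
      rw [show s + (d : ℤ) + 1 - 1 = s + d by ring] at hl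
      have hdp := hpos _ hd
      refine le_of_mul_le_mul_left ?_ hdp
      nlinarith [mul_le_mul_of_nonneg_left hl (h0 s), mul_le_mul_of_nonneg_right ih (h0 (s + d + 1))]
  refine ⟨h0, fun s t hst => ?_⟩
  have := key (t - s).toNat s
  rw [Int.toNat_of_nonneg (by lia)] at this
  simpa [add_sub_cancel] using this

theorem outer_le_inner_nat (ha : IsPF2 a) (d : ℕ) : ∀ w z : ℤ, w + 2 * d ≤ z →
    a w * a z ≤ a (w + d) * a (z - d) := by
  induction d with
  | zero => intro w z _; simp
  | succ d ih =>
    intro w z h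
    push_cast at h
    refine (ih w z (by lia)).trans ?_
    have := ha.mul_le_mul (w + d) (z - d - 1) (by lia)
    push_cast
    rw [show z - (d : ℤ) - 1 + 1 = z - d by ring] at this
    rw [show w + ((d : ℤ) + 1) = w + d + 1 by ring, show z - ((d : ℤ) + 1) = z - d - 1 by ring]
    exact this

theorem outer_le_inner (ha : IsPF2 a) {w x y z : ℤ} (hx : w ≤ x) (hy : w ≤ y)
    (h : w + z = x + y) : a w * a z ≤ a x * a y := by
  wlog hxy : x ≤ y generalizing x y
  · rw [mul_comm (a x)]
    exact this hy hx (by lia) (by lia)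
  have := ha.outer_le_inner_nat (x - w).toNat w z (by lia)
  rw [Int.toNat_of_nonneg (by lia), show w + (x - w) = x by ring,
    show z - (x - w) = y by lia] at this
  exact this

theorem pos_of_mem (ha : IsPF2 a) {s t u : ℤ} (hs : 0 < a s) (hu : 0 < a u) (hst : s ≤ t)
    (htu : t ≤ u) : 0 < a t := by
  have h := ha.outer_le_inner (w := s) (x := t) (y := s + u - t) (z := u) hst (by lia) (by lia)
  refine lt_of_le_of_ne (ha.nonneg t) fun h0 => ?_
  rw [← h0, zero_mul] at h
  exact absurd h (not_le.2 (mul_pos hs hu))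

theorem comp_neg (ha : IsPF2 a) : IsPF2 fun j => a (-j) := by
  refine ⟨fun j => ha.nonneg _, fun s t hst => ?_⟩
  have := ha.mul_le_mul (-(t + 1)) (-(s + 1)) (by lia)
  rw [show -(s + 1) + 1 = -s by ring, show -(t + 1) + 1 = -t by ring] at this
  change a (-s) * a (-(t + 1)) ≤ a (-(s + 1)) * a (-t)
  linarith

/-- Cauchy–Binet for 2×2 minors: symmetrised in the two summation indices, each term is a minor of
`a` times a minor of `b`, and the two have the same sign. -/
theorem conv_finsum (ha : IsPF2 a) (hb : IsPF2 b) (hbf : (Function.support b).Finite) :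
    IsPF2 fun j => ∑ᶠ z, a (j - z) * b z := by
  refine ⟨fun j => finsum_nonneg fun z => mul_nonneg (ha.nonneg _) (hb.nonneg _), fun s t hst => ?_⟩
  have hbf' : ((fun z : ℤ => z - 1) '' Function.support b).Finite := hbf.image _
  set K : Finset ℤ := hbf.toFinset ∪ hbf'.toFinset with hK
  have e0 : ∀ j, ∑ᶠ z, a (j - z) * b z = ∑ z ∈ K, a (j - z) * b z := by
    intro j
    refine finsum_eq_sum_of_support_subset _ fun z hz => ?_
    have : b z ≠ 0 := right_ne_zero_of_mul hz
    simp [hK, this]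
  -- Shifting the index moves the `+ 1` from `a` to `b`, so that both products contain the same
  -- values of `a`. This is why `K` also contains the support of `b` translated by `-1`.
  have e1 : ∀ j, ∑ᶠ z, a (j + 1 - z) * b z = ∑ z ∈ K, a (j - z) * b (z + 1) := by
    intro j
    rw [← finsum_comp_equiv (Equiv.addRight (1 : ℤ))]
    simp only [Equiv.coe_addRight, add_sub_add_right_eq_sub]
    refine finsum_eq_sum_of_support_subset _ fun z hz => ?_
    have : b (z + 1) ≠ 0 := right_ne_zero_of_mul hz
    simp only [hK, Finset.coe_union, Set.Finite.coe_toFinset, Set.mem_union]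
    exact Or.inr ⟨z + 1, this, by ring⟩
  simp only [e1]
  rw [e0 s, e0 t]
  simp only [Finset.sum_mul_sum]
  rw [← sub_nonneg, ← Finset.sum_sub_distrib]
  simp only [← Finset.sum_sub_distrib]
  set F : ℤ → ℤ → ℝ := fun u v => a (s - u) * b (u + 1) * (a (t - v) * b v) -
    a (s - u) * b u * (a (t - v) * b (v + 1)) with hF
  change 0 ≤ ∑ u ∈ K, ∑ v ∈ K, F u v
  have hsw : ∑ u ∈ K, ∑ v ∈ K, F u v = ∑ u ∈ K, ∑ v ∈ K, F v u := Finset.sum_comm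
  have hpos : 0 ≤ ∑ u ∈ K, ∑ v ∈ K, (F u v + F v u) := by
    have hord : ∀ u v, u ≤ v → 0 ≤ F u v + F v u := by
      intro u v huv
      have h1 := hb.mul_le_mul u v huv
      have h2 := ha.outer_le_inner (w := s - v) (x := s - u) (y := t - v) (z := t - u)
        (by lia) (by lia) (by lia)
      have := mul_nonneg (sub_nonneg.2 h1) (sub_nonneg.2 h2)
      simp only [hF]
      linarith
    refine Finset.sum_nonneg fun u _ => Finset.sum_nonneg fun v _ => ?_
    rcases le_total u v with h | h
    · exact hord u v h
    · rw [add_comm]; exact hord v u h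
  simp only [Finset.sum_add_distrib] at hpos
  linarith

end IsPF2

/-! ### Monotone transport by at most one step -/

/-- Transport between two measures on `{0, …, N-1}`, moving each unit of mass up by `0` or `1`,
exists when both likelihood ratios are monotone; it compares averages of `f` and `g`. -/
theorem sum_mul_sum_le_of_monotone_ratio (α β f g : ℕ → ℝ) (N : ℕ) (hα : ∀ i, 0 ≤ α i)
    (hβ : ∀ i, 0 ≤ β i) (h1 : ∀ s t, s ≤ t → α t * β s ≤ α s * β t)
    (h2 : ∀ s t, s ≤ t → α s * β (t + 1) ≤ α t * β (s + 1))
    (hfg : ∀ t, 0 < α t → 0 < β t → f t ≤ g t)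
    (hfg' : ∀ t, 0 < α t → 0 < β (t + 1) → f t ≤ g (t + 1)) :
    (∑ i ∈ Finset.range N, α i * f i) * ∑ i ∈ Finset.range N, β i ≤
      (∑ i ∈ Finset.range N, β i * g i) * ∑ i ∈ Finset.range N, α i := by
  set A : ℕ → ℝ := fun t => ∑ i ∈ Finset.range t, α i with hA
  set B : ℕ → ℝ := fun t => ∑ i ∈ Finset.range t, β i with hB
  have hAs : ∀ t, A (t + 1) = A t + α t := fun t => Finset.sum_range_succ _ _
  have hBs : ∀ t, B (t + 1) = B t + β t := fun t => Finset.sum_range_succ _ _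
  have hAN : 0 ≤ A N := Finset.sum_nonneg fun i _ => hα i
  have hBN : 0 ≤ B N := Finset.sum_nonneg fun i _ => hβ i
  -- After normalisation, this is the mass that has to cross from `t - 1` to `t`.
  have hy : ∀ t ≤ N, 0 ≤ A t * B N - B t * A N := by
    intro t ht
    have eA : A N = A t + ∑ i ∈ Finset.Ico t N, α i := (Finset.sum_range_add_sum_Ico _ ht).symm
    have eB : B N = B t + ∑ i ∈ Finset.Ico t N, β i := (Finset.sum_range_add_sum_Ico _ ht).symm
    have : B t * ∑ i ∈ Finset.Ico t N, α i ≤ A t * ∑ i ∈ Finset.Ico t N, β i := by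
      simp only [hA, hB, Finset.sum_mul_sum]
      refine Finset.sum_le_sum fun i hi => Finset.sum_le_sum fun j hj => ?_
      have := h1 i j ((Finset.mem_range.1 hi).le.trans (Finset.mem_Ico.1 hj).1)
      linarith
    rw [eA, eB]
    linarith
  -- This is the mass that remains at `t`. Its nonnegativity says that what enters `t` from below
  -- never exceeds what `β` requires there, so no unit moves twice.
  have hx : ∀ t, t + 1 ≤ N → 0 ≤ B (t + 1) * A N - A t * B N := by
    intro t ht
    have eA : A N = A t + ∑ i ∈ Finset.Ico t N, α i :=
      (Finset.sum_range_add_sum_Ico _ (by lia)).symm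
    have eB : B N = B (t + 1) + ∑ i ∈ Finset.Ico t (N - 1), β (i + 1) := by
      rw [Finset.sum_Ico_add', Nat.sub_add_cancel (by lia)]
      exact (Finset.sum_range_add_sum_Ico _ ht).symm
    have eB' : B (t + 1) = ∑ i ∈ Finset.range t, β (i + 1) + β 0 := Finset.sum_range_succ' _ _
    have k1 : A t * ∑ i ∈ Finset.Ico t (N - 1), β (i + 1) ≤
        (∑ i ∈ Finset.range t, β (i + 1)) * ∑ i ∈ Finset.Ico t (N - 1), α i := by
      simp only [hA, Finset.sum_mul_sum]
      refine Finset.sum_le_sum fun i hi => Finset.sum_le_sum fun j hj => ?_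
      have := h2 i j ((Finset.mem_range.1 hi).le.trans (Finset.mem_Ico.1 hj).1)
      linarith
    have k2 : ∑ i ∈ Finset.Ico t (N - 1), α i ≤ ∑ i ∈ Finset.Ico t N, α i :=
      Finset.sum_le_sum_of_subset_of_nonneg (Finset.Ico_subset_Ico_right (by lia))
        fun i _ _ => hα i
    have k3 : ∑ i ∈ Finset.range t, β (i + 1) ≤ B (t + 1) := by rw [eB']; linarith [hβ 0]
    have k4 : 0 ≤ ∑ i ∈ Finset.Ico t (N - 1), α i := Finset.sum_nonneg fun i _ => hα i
    have k5 : 0 ≤ B (t + 1) := Finset.sum_nonneg fun i _ => hβ i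
    have k6 := mul_le_mul k3 k2 k4 k5
    have : A t * B N ≤ B (t + 1) * A N := by rw [eB, eA]; linarith
    linarith
  have stay : ∀ t, t + 1 ≤ N →
      f t * (B (t + 1) * A N - A t * B N) ≤ g t * (B (t + 1) * A N - A t * B N) := by
    intro t ht
    rcases (hx t ht).eq_or_lt with h | h
    · rw [← h]; simp
    refine mul_le_mul_of_nonneg_right (hfg t ?_ ?_) h.le
    · refine lt_of_le_of_ne (hα t) fun h0 => ?_
      have := hy (t + 1) ht
      rw [hAs, ← h0] at this
      linarith
    · refine lt_of_le_of_ne (hβ t) fun h0 => ?_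
      have := hy t (by lia)
      rw [hBs, ← h0] at h
      linarith
  have move : ∀ t, t + 2 ≤ N → f t * (A (t + 1) * B N - B (t + 1) * A N) ≤
      g (t + 1) * (A (t + 1) * B N - B (t + 1) * A N) := by
    intro t ht
    rcases (hy (t + 1) (by lia)).eq_or_lt with h | h
    · rw [← h]; simp
    refine mul_le_mul_of_nonneg_right (hfg' t ?_ ?_) h.le
    · refine lt_of_le_of_ne (hα t) fun h0 => ?_
      have := hx t (by lia)
      rw [hAs, ← h0] at h
      linarith
    · refine lt_of_le_of_ne (hβ _) fun h0 => ?_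
      have := hx (t + 1) ht
      rw [hBs (t + 1), ← h0] at this
      linarith
  -- The last term is the contribution of the mass in transit from `t` to `t + 1`; it vanishes at `t
  -- + 1 = N`.
  have main : ∀ t, t + 1 ≤ N →
      (∑ i ∈ Finset.range (t + 1), α i * f i) * B N ≤
        (∑ i ∈ Finset.range (t + 1), β i * g i) * A N +
          f t * (A (t + 1) * B N - B (t + 1) * A N) := by
    intro t
    induction t with
    | zero =>
      intro ht
      have := stay 0 ht
      simp only [hAs, hBs, zero_add, Finset.range_one, Finset.sum_singleton] at this ⊢
      simp only [hA, hB, Finset.range_zero, Finset.sum_empty, zero_add] at this ⊢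
      linarith
    | succ t ih =>
      intro ht
      have i1 := ih (by lia)
      have i2 := stay (t + 1) ht
      have i3 := move t ht
      rw [Finset.sum_range_succ _ (t + 1), Finset.sum_range_succ _ (t + 1)]
      rw [hAs (t + 1), hBs (t + 1)]
      rw [hBs (t + 1)] at i2
      linarith
  cases N with
  | zero => simp
  | succ n =>
    have := main n le_rfl
    change _ * B (n + 1) ≤ _ * A (n + 1)
    linarith

/-! ### Moments of a submultiplicative sequence -/

section HalfLine

variable {r : ℕ → ℝ} {N : ℕ}

theorem mul_sum_Ico_le (h0 : ∀ i, 0 ≤ r i) (hr : ∀ i j, r 0 * r (i + j) ≤ r i * r j) (i : ℕ) :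
    r 0 * ∑ k ∈ Finset.Ico i N, r k ≤ r i * ∑ k ∈ Finset.range N, r k := by
  rw [Finset.sum_Ico_eq_sum_range, Finset.mul_sum, Finset.mul_sum]
  refine (Finset.sum_le_sum fun j _ => hr i j).trans ?_
  exact Finset.sum_le_sum_of_subset_of_nonneg (Finset.range_mono (Nat.sub_le _ _))
    fun j _ _ => mul_nonneg (h0 _) (h0 _)

theorem sum_mul_sum_Ico (w : ℕ → ℝ) :
    ∑ i ∈ Finset.range N, w i * ∑ k ∈ Finset.Ico i N, r k =
      ∑ k ∈ Finset.range N, (∑ i ∈ Finset.range (k + 1), w i) * r k := by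
  simp only [Finset.mul_sum, Finset.sum_mul]
  refine Finset.sum_comm' fun i k => ?_
  simp only [Finset.mem_range, Finset.mem_Ico]
  lia

/-- Weight the tail bound at `i` by `w i` and exchange the sums. The weights `1` and `i` yield the
first and second moments. -/
theorem mul_sum_weighted_le (h0 : ∀ i, 0 ≤ r i) (hr : ∀ i j, r 0 * r (i + j) ≤ r i * r j)
    (w : ℕ → ℝ) (hw : ∀ i, 0 ≤ w i) :
    r 0 * ∑ k ∈ Finset.range N, (∑ i ∈ Finset.range (k + 1), w i) * r k ≤
      (∑ i ∈ Finset.range N, w i * r i) * ∑ k ∈ Finset.range N, r k := by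
  rw [← sum_mul_sum_Ico, Finset.mul_sum, Finset.sum_mul]
  refine Finset.sum_le_sum fun i _ => ?_
  have := mul_le_mul_of_nonneg_left (mul_sum_Ico_le (N := N) h0 hr i) (hw i)
  linarith

theorem first_moment_le (h0 : ∀ i, 0 ≤ r i) (hr : ∀ i j, r 0 * r (i + j) ≤ r i * r j) :
    r 0 * (∑ k ∈ Finset.range N, k * r k + ∑ k ∈ Finset.range N, r k) ≤
      (∑ k ∈ Finset.range N, r k) ^ 2 := by
  have := mul_sum_weighted_le (N := N) h0 hr (fun _ => 1) fun _ => zero_le_one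
  simp only [Finset.sum_const, Finset.card_range, nsmul_eq_mul, mul_one, one_mul] at this
  rw [← Finset.sum_add_distrib, sq]
  refine le_trans (le_of_eq ?_) this
  congr 1
  refine Finset.sum_congr rfl fun k _ => ?_
  push_cast
  ring

theorem second_moment_le (h0 : ∀ i, 0 ≤ r i) (hr : ∀ i j, r 0 * r (i + j) ≤ r i * r j) :
    r 0 * (∑ k ∈ Finset.range N, (k : ℝ) ^ 2 * r k + ∑ k ∈ Finset.range N, k * r k) ≤
      2 * ((∑ k ∈ Finset.range N, r k) * ∑ k ∈ Finset.range N, k * r k) := by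
  have := mul_sum_weighted_le (N := N) h0 hr (fun i => (i : ℝ)) fun i => Nat.cast_nonneg i
  have hg : ∀ k : ℕ, ∑ i ∈ Finset.range (k + 1), (i : ℝ) = ((k : ℝ) ^ 2 + k) / 2 := by
    intro k
    induction k with
    | zero => simp
    | succ k ih => rw [Finset.sum_range_succ, ih]; push_cast; ring
  simp only [hg] at this
  rw [← Finset.sum_add_distrib]
  have e : ∑ k ∈ Finset.range N, ((k : ℝ) ^ 2 * r k + k * r k) =
      2 * ∑ k ∈ Finset.range N, ((k : ℝ) ^ 2 + k) / 2 * r k := by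
    rw [Finset.mul_sum]
    exact Finset.sum_congr rfl fun k _ => by ring
  rw [e]
  linarith

end HalfLine

/-! ### Variance against the mass at one point -/

/-- The bound on the variance `s + t - (x - y)²` of a distribution whose restrictions to the two
sides of a mode of height `M` have masses `R`, `L`, first moments `x`, `y` and second moments
`s`, `t`. -/
theorem sq_mul_two_sided_le {M R L x y s t : ℝ} (hM : 0 < M) (hR : M ≤ R) (hL : M ≤ L)
    (hsum : R + L = 1 + M) (hx : M * (x + R) ≤ R ^ 2) (hy : M * (y + L) ≤ L ^ 2)
    (hs : M * (s + x) ≤ 2 * (R * x)) (ht : M * (t + y) ≤ 2 * (L * y)) :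
    M ^ 2 * (s + t - (x - y) ^ 2) ≤
      ((2 * R - M) ^ 2 + (2 * L - M) ^ 2) / 4 - M ^ 2 / 2 := by
  set u := M * x with hu
  set v := M * y with hv
  -- `hx` and `hy` say exactly `u ≤ U` and `v ≤ V`.
  set U := R * (R - M) with hU
  set V := L * (L - M) with hV
  have h1 : M ^ 2 * s ≤ (2 * R - M) * u := by
    have := mul_le_mul_of_nonneg_left hs hM.le
    rw [hu]; linarith
  have h2 : M ^ 2 * t ≤ (2 * L - M) * v := by
    have := mul_le_mul_of_nonneg_left ht hM.le
    rw [hv]; linarith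
  have hUV : U - V = R - L := by
    have : U - V = (R - L) * (R + L - M) := by rw [hU, hV]; ring
    rw [this, hsum]; ring
  have hδ : 0 ≤ U - u := by rw [hU, hu]; linarith
  have hε : 0 ≤ V - v := by rw [hV, hv]; linarith
  have h3 : (2 * R - M) * u + (2 * L - M) * v - (u - v) ^ 2 ≤
      (2 * R - M) * U + (2 * L - M) * V - (U - V) ^ 2 := by
    -- Exact Taylor expansion at `(U, V)` of a concave quadratic. Since `U - V = R - L`, its partial
    -- derivatives there are `2L - M` and `2R - M`, both nonnegative.
    have e : (2 * R - M) * U + (2 * L - M) * V - (U - V) ^ 2 -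
        ((2 * R - M) * u + (2 * L - M) * v - (u - v) ^ 2) =
        (U - u) * (2 * R - M - 2 * (U - V)) + (V - v) * (2 * L - M + 2 * (U - V)) +
          ((U - u) - (V - v)) ^ 2 := by ring
    have p1 : 0 ≤ (U - u) * (2 * R - M - 2 * (U - V)) := by
      rw [hUV]; exact mul_nonneg hδ (by linarith)
    have p2 : 0 ≤ (V - v) * (2 * L - M + 2 * (U - V)) := by
      rw [hUV]; exact mul_nonneg hε (by linarith)
    linarith [sq_nonneg ((U - u) - (V - v))]
  have h4 : (2 * R - M) * U + (2 * L - M) * V - (U - V) ^ 2 =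
      ((2 * R - M) ^ 2 + (2 * L - M) ^ 2) / 4 - M ^ 2 / 2 := by
    have hL' : L = 1 + M - R := by linarith
    rw [hUV, hU, hV, hL']
    ring
  have h5 : M ^ 2 * (x - y) ^ 2 = (u - v) ^ 2 := by rw [hu, hv]; ring
  linarith [mul_add (M ^ 2) s t, mul_sub (M ^ 2) (s + t) ((x - y) ^ 2)]

namespace IsPF2

variable {p : ℤ → ℝ}

theorem right_submul (hp : IsPF2 p) (m : ℤ) (i j : ℕ) :
    p (m + (0 : ℕ)) * p (m + (i + j : ℕ)) ≤ p (m + i) * p (m + j) := by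
  apply hp.outer_le_inner <;> push_cast <;> lia

theorem left_submul (hp : IsPF2 p) (m : ℤ) (i j : ℕ) :
    p (m - (0 : ℕ)) * p (m - (i + j : ℕ)) ≤ p (m - i) * p (m - j) := by
  rw [mul_comm]
  apply hp.outer_le_inner <;> push_cast <;> lia

end IsPF2

/-- The sum of `φ * p` over the `N` integers above `m` and the `N` integers up to `m`. -/
def splitSum (p φ : ℤ → ℝ) (m : ℤ) (N : ℕ) : ℝ :=
  ∑ k ∈ Finset.range N, p (m + 1 + k) * φ (m + 1 + k) +
    ∑ k ∈ Finset.range N, p (m - k) * φ (m - k)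

/-- Lets both sides start at `m`, as the half-line bounds require, with `m` then counted twice. The
left side gains the index `m - N`, where `p` vanishes. -/
theorem splitSum_eq_add_sub (p φ : ℤ → ℝ) (m : ℤ) (N : ℕ) (hN : p (m - N) = 0) :
    splitSum p φ m N = ∑ k ∈ Finset.range (N + 1), p (m + k) * φ (m + k) +
      ∑ k ∈ Finset.range (N + 1), p (m - k) * φ (m - k) - p m * φ m := by
  rw [Finset.sum_range_succ' _ N, Finset.sum_range_succ (fun k : ℕ => p (m - k) * φ (m - k)) N, hN]
  simp only [splitSum, Nat.cast_add, Nat.cast_one, Nat.cast_zero, add_zero, zero_mul]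
  have : ∀ k : ℤ, m + 1 + k = m + (k + 1) := fun k => by ring
  simp only [this]
  ring

theorem two_sided_moments {p : ℤ → ℝ} (hp : IsPF2 p) (m : ℤ) (N : ℕ) (hN : p (m - N) = 0)
    (h1 : splitSum p 1 m N = 1) (hm : 0 < p m) :
    ∃ R L : ℝ, R = ∑ k ∈ Finset.range (N + 1), p (m + k) ∧
      L = ∑ k ∈ Finset.range (N + 1), p (m - k) ∧ p m ≤ R ∧ p m ≤ L ∧ R + L = 1 + p m ∧
      p m ^ 2 * (splitSum p (fun j => ((j - m : ℤ) : ℝ) ^ 2) m N -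
        (splitSum p (fun j => ((j - m : ℤ) : ℝ)) m N) ^ 2) ≤
      ((2 * R - p m) ^ 2 + (2 * L - p m) ^ 2) / 4 - p m ^ 2 / 2 := by
  have rs : ∀ i j : ℕ, _ := hp.right_submul m
  have ls : ∀ i j : ℕ, _ := hp.left_submul m
  have r0 : ∀ i : ℕ, 0 ≤ p (m + i) := fun i => hp.nonneg _
  have l0 : ∀ i : ℕ, 0 ≤ p (m - i) := fun i => hp.nonneg _
  have hx := first_moment_le (r := fun k : ℕ => p (m + k)) (N := N + 1) r0 rs
  have hy := first_moment_le (r := fun k : ℕ => p (m - k)) (N := N + 1) l0 ls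
  have hs := second_moment_le (r := fun k : ℕ => p (m + k)) (N := N + 1) r0 rs
  have ht := second_moment_le (r := fun k : ℕ => p (m - k)) (N := N + 1) l0 ls
  have hR : p m ≤ ∑ k ∈ Finset.range (N + 1), p (m + k) := by
    have := Finset.single_le_sum (s := Finset.range (N + 1)) (fun i _ => r0 i)
      (Finset.mem_range.2 N.succ_pos)
    simpa using this
  have hL : p m ≤ ∑ k ∈ Finset.range (N + 1), p (m - k) := by
    have := Finset.single_le_sum (s := Finset.range (N + 1)) (fun i _ => l0 i)
      (Finset.mem_range.2 N.succ_pos)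
    simpa using this
  rw [splitSum_eq_add_sub _ _ _ _ hN] at h1
  simp only [Pi.one_apply, mul_one] at h1
  rw [splitSum_eq_add_sub _ _ _ _ hN, splitSum_eq_add_sub _ _ _ _ hN]
  simp only [Nat.cast_zero, add_zero, sub_zero] at hx hy hs ht
  refine ⟨_, _, rfl, rfl, hR, hL, by linarith, ?_⟩
  have := sq_mul_two_sided_le hm hR hL (by linarith) hx hy hs ht
  refine le_trans (le_of_eq ?_) this
  simp only [add_sub_cancel_left, sub_sub_cancel_left, Int.cast_neg, Int.cast_natCast, neg_sq,
    sub_self, Int.cast_zero, mul_comm (p _)]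
  simp [sub_eq_add_neg]

/-- A log-concave distribution with a mode `m` has variance at most `p(m)⁻² - 1`. -/
theorem sq_mul_one_add_variance_le {p : ℤ → ℝ} (hp : IsPF2 p) (m : ℤ) (N : ℕ)
    (hN : p (m - N) = 0) (h1 : splitSum p 1 m N = 1) (hm : 0 < p m) :
    p m ^ 2 * (1 + (splitSum p (fun j => ((j - m : ℤ) : ℝ) ^ 2) m N -
        (splitSum p (fun j => ((j - m : ℤ) : ℝ)) m N) ^ 2)) ≤ 1 := by
  obtain ⟨R, L, -, -, hR, hL, hs, h⟩ := two_sided_moments hp m N hN h1 hm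
  have hM1 : p m ≤ 1 := by linarith
  -- As `R + L = 1 + M` with `M = p m`, the claim reduces to `(R - L)² + M² ≤ 1`, and `(R - M)(L -
  -- M) ≥ 0` gives `|R - L| ≤ 1 - M`.
  nlinarith [mul_nonneg (sub_nonneg.2 hR) (sub_nonneg.2 hL)]

theorem sq_mul_one_add_two_variance_le_of_symm {p : ℤ → ℝ} (hp : IsPF2 p) (m : ℤ) (N : ℕ)
    (hN : p (m - N) = 0) (h1 : splitSum p 1 m N = 1) (hm : 0 < p m)
    (hsymm : ∀ j, p (2 * m - j) = p j) :
    p m ^ 2 * (1 + 2 * (splitSum p (fun j => ((j - m : ℤ) : ℝ) ^ 2) m N -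
        (splitSum p (fun j => ((j - m : ℤ) : ℝ)) m N) ^ 2)) ≤ 1 := by
  obtain ⟨R, L, hR', hL', hR, hL, hs, h⟩ := two_sided_moments hp m N hN h1 hm
  have hRL : R = L := by
    rw [hR', hL']
    refine Finset.sum_congr rfl fun k _ => ?_
    rw [← hsymm]
    congr 1
    ring
  subst hRL
  have e : 2 * R - p m = 1 := by linarith
  rw [e] at h
  linarith

/-- A log-concave distribution symmetric about the half-integer `m + 1/2`. -/
theorem sq_mul_one_add_two_moment_le_of_symm_half {p : ℤ → ℝ} (hp : IsPF2 p) (m : ℤ) (N : ℕ)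
    (h1 : splitSum p 1 m N = 1) (hm : 0 < p m) (hsymm : ∀ j, p (2 * m + 1 - j) = p j) :
    p m ^ 2 * (1 + 2 * splitSum p (fun j => ((j : ℝ) - m - 1 / 2) ^ 2) m N) ≤ 1 := by
  have hr : ∀ k : ℕ, p (m + 1 + k) = p (m - k) := by
    intro k
    rw [← hsymm]
    congr 1
    ring
  have ls : ∀ i j : ℕ, _ := hp.left_submul m
  have l0 : ∀ i : ℕ, 0 ≤ p (m - i) := fun i => hp.nonneg _
  have hy := first_moment_le (r := fun k : ℕ => p (m - k)) (N := N) l0 ls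
  have ht := second_moment_le (r := fun k : ℕ => p (m - k)) (N := N) l0 ls
  simp only [Nat.cast_zero, sub_zero] at hy ht
  simp only [splitSum, hr, Pi.one_apply, mul_one] at h1 ⊢
  have hR : ∑ k ∈ Finset.range N, p (m - k) = 1 / 2 := by linarith
  have hM : p m ≤ 1 / 2 := by
    rw [← hR]
    have hN0 : 0 < N := by
      rcases Nat.eq_zero_or_pos N with h | h
      · simp [h] at hR
      · exact h
    have := Finset.single_le_sum (s := Finset.range N) (fun i _ => l0 i) (Finset.mem_range.2 hN0)
    simpa using this
  rw [hR] at hy ht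
  have e1 : ∑ k ∈ Finset.range N, p (m - k) * (((m + 1 + (k : ℤ) : ℤ) : ℝ) - m - 1 / 2) ^ 2 =
      ∑ k ∈ Finset.range N, (k : ℝ) ^ 2 * p (m - k) + ∑ k ∈ Finset.range N, k * p (m - k) +
        (1 / 4) * ∑ k ∈ Finset.range N, p (m - k) := by
    rw [Finset.mul_sum, ← Finset.sum_add_distrib, ← Finset.sum_add_distrib]
    refine Finset.sum_congr rfl fun k _ => ?_
    push_cast
    ring
  have e2 : ∑ k ∈ Finset.range N, p (m - k) * (((m - (k : ℤ) : ℤ) : ℝ) - m - 1 / 2) ^ 2 =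
      ∑ k ∈ Finset.range N, (k : ℝ) ^ 2 * p (m - k) + ∑ k ∈ Finset.range N, k * p (m - k) +
        (1 / 4) * ∑ k ∈ Finset.range N, p (m - k) := by
    rw [Finset.mul_sum, ← Finset.sum_add_distrib, ← Finset.sum_add_distrib]
    refine Finset.sum_congr rfl fun k _ => ?_
    push_cast
    ring
  rw [e1, e2, hR]
  -- With `M = p m`, `ht` and then `hy` bound the left side by `1 - 2M + 3M²/2`, which is at most 1
  -- because `M ≤ 1/2`.
  nlinarith [mul_le_mul_of_nonneg_left ht hm.le]

/-! ### Joint law of the integer sum and the weighted sum -/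

/-- The embedding `k ↦ m + k` of the naturals onto the integers from `m` on. -/
def natShift (m : ℤ) : ℕ ↪ ℤ := ⟨fun k => m + k, fun _ _ h => by simpa using h⟩

@[simp]
theorem natShift_apply (m : ℤ) (k : ℕ) : natShift m k = m + k := rfl

section Discrete

variable {Ω : Type*} [MeasurableSpace Ω] {P : Measure Ω}

theorem massFn_nonneg (X : Ω → ℤ) (j : ℤ) : 0 ≤ massFn X P j := measureReal_nonneg

theorem IsDiscreteLogConcave.isPF2 {X : Ω → ℤ} (h : IsDiscreteLogConcave X P) :
    IsPF2 (massFn X P) :=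
  .of_logConcave (massFn_nonneg X) h.mul_le_sq h.support_interval

theorem massFn_neg (X : Ω → ℤ) (j : ℤ) : massFn (fun ω => -X ω) P j = massFn X P (-j) := by
  simp only [massFn, neg_eq_iff_eq_neg]

/-- `P(Y₁ = j, c ≤ Y₂)`. -/
def upMass (Y : Ω → ℤ × ℝ) (P : Measure Ω) (c : ℝ) (j : ℤ) : ℝ :=
  P.real {ω | (Y ω).1 = j ∧ c ≤ (Y ω).2}

/-- `P(Y₁ = j, c < Y₂)`. -/
def strictUpMass (Y : Ω → ℤ × ℝ) (P : Measure Ω) (c : ℝ) (j : ℤ) : ℝ :=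
  P.real {ω | (Y ω).1 = j ∧ c < (Y ω).2}

theorem upMass_nonneg (Y : Ω → ℤ × ℝ) (c : ℝ) (j : ℤ) : 0 ≤ upMass Y P c j := measureReal_nonneg

theorem strictUpMass_nonneg (Y : Ω → ℤ × ℝ) (c : ℝ) (j : ℤ) : 0 ≤ strictUpMass Y P c j :=
  measureReal_nonneg

/-- The first component of `Y` is log-concave, and conditionally on it the second component
increases strictly with it, in the sense of `P(c ≤ Y₂ | Y₁ = j) ≤ P(c < Y₂ | Y₁ = j + 1)`. -/
structure IsRankMonotone (Y : Ω → ℤ × ℝ) (P : Measure Ω) : Prop where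
  isPF2 : IsPF2 (massFn (fun ω => (Y ω).1) P)
  finite : (Function.support (massFn (fun ω => (Y ω).1) P)).Finite
  le : ∀ c j, upMass Y P c j * massFn (fun ω => (Y ω).1) P (j + 1) ≤
    strictUpMass Y P c (j + 1) * massFn (fun ω => (Y ω).1) P j

/-- Telescoping: the conditional probability of `c ≤ Y₂` at one index is absorbed by that of `c <
Y₂` at the next. -/
theorem IsRankMonotone.sum_sub_le {Y : Ω → ℤ × ℝ} (h : IsRankMonotone Y P) (x : ℝ) (A : ℤ)
    (n : ℕ) (hpos : ∀ k : ℕ, k ≤ n → 0 < massFn (fun ω => (Y ω).1) P (A + k)) :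
    ∑ k ∈ Finset.range (n + 1), (upMass Y P x (A + k) - strictUpMass Y P x (A + k)) /
        massFn (fun ω => (Y ω).1) P (A + k) ≤
      upMass Y P x (A + n) / massFn (fun ω => (Y ω).1) P (A + n) := by
  induction n with
  | zero =>
    rw [Finset.sum_range_one]
    exact div_le_div_of_nonneg_right (sub_le_self _ (strictUpMass_nonneg _ _ _)) (hpos 0 le_rfl).le
  | succ n ih =>
    rw [Finset.sum_range_succ]
    have h1 := ih fun k hk => hpos k (hk.trans n.le_succ)
    have h2 := h.le x (A + n)
    have w1 := hpos n n.le_succ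
    have w2 := hpos (n + 1) le_rfl
    have e : A + ((n + 1 : ℕ) : ℤ) = A + n + 1 := by push_cast; ring
    rw [e] at w2 ⊢
    rw [← div_le_div_iff₀ w1 w2] at h2
    rw [sub_div]
    linarith

section Sum

variable {ι : Type*} {X : ι → Ω → ℤ} (a : ι → ℝ)

theorem measurable_pair {X : Ω → ℤ} (hX : Measurable X) (a : ℝ) :
    Measurable fun ω => (X ω, a * (X ω : ℝ)) := by
  fun_prop

theorem measurable_sum_pair (hX : ∀ i, Measurable (X i)) (s : Finset ι) :
    Measurable (∑ i ∈ s, fun ω => (X i ω, a i * (X i ω : ℝ))) :=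
  Finset.sum_induction _ Measurable (fun _ _ => Measurable.add) measurable_zero
    fun i _ => measurable_pair (hX i) (a i)

theorem indepFun_sum_pair (hind : iIndepFun X P) (hX : ∀ i, Measurable (X i)) {s : Finset ι}
    {i : ι} (hi : i ∉ s) : IndepFun (∑ i ∈ s, fun ω => (X i ω, a i * (X i ω : ℝ))) (X i) P := by
  have hZ : iIndepFun (fun i ω => (X i ω, a i * (X i ω : ℝ))) P :=
    hind.comp (fun i z => (z, a i * (z : ℝ))) fun i => by fun_prop
  exact (hZ.indepFun_finsetSum_of_notMem (fun i => measurable_pair (hX i) (a i)) hi).comp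
    measurable_id measurable_fst

end Sum

variable [IsProbabilityMeasure P]

theorem ae_mem_of_support_subset {X : Ω → ℤ} {K : Finset ℤ}
    (hK : Function.support (massFn X P) ⊆ K) : ∀ᵐ ω ∂P, X ω ∈ K := by
  have : ∀ z : ℤ, z ∉ K → P {ω | X ω = z} = 0 := by
    intro z hz
    have : massFn X P z = 0 := by
      by_contra h
      exact hz (hK h)
    exact (measureReal_eq_zero_iff).1 this
  rw [ae_iff]
  refine measure_mono_null (t := ⋃ z : {z : ℤ // z ∉ K}, {ω | X ω = z}) ?_ ?_
  · intro ω hω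
    exact Set.mem_iUnion.2 ⟨⟨X ω, hω⟩, rfl⟩
  · exact measure_iUnion_null fun z => this z z.2

theorem measureReal_eq_sum_inter {X : Ω → ℤ} (hX : Measurable X) {K : Finset ℤ}
    (hK : Function.support (massFn X P) ⊆ K) {E : Set Ω} (hE : MeasurableSet E) :
    P.real E = ∑ z ∈ K, P.real ({ω | X ω = z} ∩ E) := by
  have hm : ∀ z, MeasurableSet {ω | X ω = z} := fun z => hX (measurableSet_singleton z)
  rw [← measureReal_biUnion_finset]
  · refine measureReal_congr ?_
    filter_upwards [ae_mem_of_support_subset hK] with ω hω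
    refine propext ?_
    change ω ∈ E ↔ ω ∈ ⋃ b ∈ K, {ω | X ω = b} ∩ E
    simp [hω]
  · intro y _ z _ hyz
    refine Set.disjoint_left.2 ?_
    rintro ω ⟨h1, -⟩ ⟨h2, -⟩
    exact hyz (h1.symm.trans h2)
  · exact fun z _ => (hm z).inter hE

theorem IndepFun.measureReal_mem_eq_sum {β : Type*} [MeasurableSpace β] {X : Ω → ℤ} {Y : Ω → β}
    (h : IndepFun Y X P) (hX : Measurable X) (hY : Measurable Y) {K : Finset ℤ}
    (hK : Function.support (massFn X P) ⊆ K) {C : ℤ → Set β} (hC : ∀ z, MeasurableSet (C z)) :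
    P.real {ω | Y ω ∈ C (X ω)} = ∑ z ∈ K, P.real {ω | Y ω ∈ C z} * massFn X P z := by
  have hE : MeasurableSet {ω | Y ω ∈ C (X ω)} := by
    have : {ω | Y ω ∈ C (X ω)} = ⋃ z : ℤ, {ω | X ω = z} ∩ Y ⁻¹' C z := by
      ext ω; simp
    rw [this]
    exact MeasurableSet.iUnion fun z => (hX (measurableSet_singleton z)).inter (hY (hC z))
  rw [measureReal_eq_sum_inter hX hK hE]
  refine Finset.sum_congr rfl fun z _ => ?_
  have e : {ω | X ω = z} ∩ {ω | Y ω ∈ C (X ω)} = Y ⁻¹' C z ∩ X ⁻¹' {z} := by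
    ext ω
    simp only [Set.mem_inter_iff, Set.mem_ofPred_eq, Set.mem_preimage, Set.mem_singleton_iff]
    constructor
    · rintro ⟨h1, h2⟩; exact ⟨h1 ▸ h2, h1⟩
    · rintro ⟨h1, h2⟩; exact ⟨h2, h2.symm ▸ h1⟩
  rw [e, measureReal_def, h.measure_inter_preimage_eq_mul _ _ (hC z) (measurableSet_singleton z),
    ENNReal.toReal_mul]
  rfl

theorem upMass_le (Y : Ω → ℤ × ℝ) (c : ℝ) (j : ℤ) :
    upMass Y P c j ≤ massFn (fun ω => (Y ω).1) P j :=
  measureReal_mono fun _ h => h.1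

theorem strictUpMass_le (Y : Ω → ℤ × ℝ) (c : ℝ) (j : ℤ) :
    strictUpMass Y P c j ≤ massFn (fun ω => (Y ω).1) P j :=
  measureReal_mono fun _ h => h.1

theorem strictUpMass_le_upMass (Y : Ω → ℤ × ℝ) (c : ℝ) (j : ℤ) :
    strictUpMass Y P c j ≤ upMass Y P c j :=
  measureReal_mono fun _ h => ⟨h.1, h.2.le⟩

theorem upMass_le_strictUpMass {Y : Ω → ℤ × ℝ} {c d : ℝ} (h : d < c) (j : ℤ) :
    upMass Y P c j ≤ strictUpMass Y P d j :=
  measureReal_mono fun _ hω => ⟨hω.1, h.trans_le hω.2⟩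

section AddIndependent

variable {X : Ω → ℤ} {Y : Ω → ℤ × ℝ} {a : ℝ} {K : Finset ℤ}

theorem massFn_fst_add (h : IndepFun Y X P) (hX : Measurable X) (hY : Measurable Y)
    (hK : Function.support (massFn X P) ⊆ K) (j : ℤ) :
    massFn (fun ω => (Y ω + (X ω, a * X ω)).1) P j =
      ∑ z ∈ K, massFn (fun ω => (Y ω).1) P (j - z) * massFn X P z := by
  have := IndepFun.measureReal_mem_eq_sum h hX hY hK (C := fun z => {y | y.1 = j - z})
    fun z => measurable_fst (measurableSet_singleton _)
  simpa only [massFn, Prod.fst_add, Set.mem_ofPred_eq, eq_sub_iff_add_eq] using this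

theorem massFn_fst_add_eq_finsum (h : IndepFun Y X P) (hX : Measurable X) (hY : Measurable Y)
    (hfin : (Function.support (massFn X P)).Finite) (j : ℤ) :
    massFn (fun ω => (Y ω + (X ω, a * X ω)).1) P j =
      ∑ᶠ z, massFn (fun ω => (Y ω).1) P (j - z) * massFn X P z := by
  rw [massFn_fst_add h hX hY (K := hfin.toFinset) (by simp)]
  refine (finsum_eq_sum_of_support_subset _ fun z hz => ?_).symm
  have : massFn X P z ≠ 0 := right_ne_zero_of_mul hz
  simpa using this

/-- If the laws of two independent variables are symmetric, so is the law of their sum. -/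
theorem exists_massFn_fst_add_symm (h : IndepFun Y X P) (hX : Measurable X) (hY : Measurable Y)
    (hfin : (Function.support (massFn X P)).Finite)
    (hXs : ∃ c, ∀ j, massFn X P (c - j) = massFn X P j)
    (hYs : ∃ c, ∀ j, massFn (fun ω => (Y ω).1) P (c - j) = massFn (fun ω => (Y ω).1) P j) :
    ∃ c, ∀ j, massFn (fun ω => (Y ω + (X ω, a * X ω)).1) P (c - j) =
      massFn (fun ω => (Y ω + (X ω, a * X ω)).1) P j := by
  obtain ⟨c, hc⟩ := hXs
  obtain ⟨d, hd⟩ := hYs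
  refine ⟨d + c, fun j => ?_⟩
  rw [massFn_fst_add_eq_finsum h hX hY hfin, massFn_fst_add_eq_finsum h hX hY hfin,
    ← finsum_comp_equiv (Equiv.subLeft c)]
  refine finsum_congr fun z => ?_
  rw [Equiv.subLeft_apply, hc, ← hd (j - z)]
  congr 2
  ring

theorem upMass_add (h : IndepFun Y X P) (hX : Measurable X) (hY : Measurable Y)
    (hK : Function.support (massFn X P) ⊆ K) (c : ℝ) (j : ℤ) :
    upMass (fun ω => Y ω + (X ω, a * X ω)) P c j =
      ∑ z ∈ K, upMass Y P (c - a * z) (j - z) * massFn X P z := by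
  have := IndepFun.measureReal_mem_eq_sum h hX hY hK
    (C := fun z => {y | y.1 = j - z ∧ c - a * z ≤ y.2})
    fun z => (measurable_fst (measurableSet_singleton _)).inter (measurable_snd measurableSet_Ici)
  simpa only [upMass, Prod.fst_add, Prod.snd_add, Set.mem_ofPred_eq, eq_sub_iff_add_eq,
    sub_le_iff_le_add] using this

theorem strictUpMass_add (h : IndepFun Y X P) (hX : Measurable X) (hY : Measurable Y)
    (hK : Function.support (massFn X P) ⊆ K) (c : ℝ) (j : ℤ) :
    strictUpMass (fun ω => Y ω + (X ω, a * X ω)) P c j =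
      ∑ z ∈ K, strictUpMass Y P (c - a * z) (j - z) * massFn X P z := by
  have := IndepFun.measureReal_mem_eq_sum h hX hY hK
    (C := fun z => {y | y.1 = j - z ∧ c - a * z < y.2})
    fun z => (measurable_fst (measurableSet_singleton _)).inter (measurable_snd measurableSet_Ioi)
  simpa only [strictUpMass, Prod.fst_add, Prod.snd_add, Set.mem_ofPred_eq, eq_sub_iff_add_eq,
    sub_lt_iff_lt_add] using this

end AddIndependent

theorem Set.Finite.exists_subset_map_range {s : Set ℤ} (hs : s.Finite) :
    ∃ (m : ℤ) (N : ℕ), s ⊆ ((Finset.range N).map (natShift m) : Finset ℤ) := by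
  obtain ⟨m, hm⟩ := hs.bddBelow
  obtain ⟨M, hM⟩ := hs.bddAbove
  refine ⟨m, (M - m + 1).toNat, fun z hz => ?_⟩
  have h1 := hm hz
  have h2 := hM hz
  simp only [Finset.coe_map, Finset.coe_range, Set.mem_image, Set.mem_Iio, natShift_apply]
  exact ⟨(z - m).toNat, by lia, by lia⟩

theorem IsRankMonotone.add {X : Ω → ℤ} {Y : Ω → ℤ × ℝ} {a : ℝ} (hYm : IsRankMonotone Y P)
    (ha : 0 < a) (h : IndepFun Y X P) (hX : Measurable X) (hY : Measurable Y)
    (hlc : IsPF2 (massFn X P)) (hfin : (Function.support (massFn X P)).Finite) :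
    IsRankMonotone (fun ω => Y ω + (X ω, a * X ω)) P := by
  obtain ⟨m, N, hK⟩ := hfin.exists_subset_map_range
  have hK' : Function.support (massFn X P) ⊆ hfin.toFinset := by simp
  refine ⟨?_, ?_, ?_⟩
  · rw [funext (massFn_fst_add_eq_finsum h hX hY hfin)]
    exact hYm.isPF2.conv_finsum hlc hfin
  · refine (hYm.finite.add hfin).subset fun j hj => ?_
    rw [Function.mem_support, massFn_fst_add h hX hY hK'] at hj
    obtain ⟨z, -, hz⟩ := Finset.exists_ne_zero_of_sum_ne_zero hj
    exact ⟨j - z, left_ne_zero_of_mul hz, z, right_ne_zero_of_mul hz, by ring⟩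
  · intro c j
    rw [massFn_fst_add h hX hY hK, massFn_fst_add h hX hY hK, upMass_add h hX hY hK,
      strictUpMass_add h hX hY hK]
    simp only [Finset.sum_map, natShift_apply]
    set W := massFn (fun ω => (Y ω).1) P with hW
    set p := massFn X P with hp
    have hW0 := hYm.isPF2.nonneg
    have hp0 := hlc.nonneg
    -- Where `W` vanishes so does `upMass`, so the convention `x / 0 = 0` does no harm.
    have e1 : ∀ z : ℤ, W (j - z) * p z * (upMass Y P (c - a * z) (j - z) / W (j - z)) =
        upMass Y P (c - a * z) (j - z) * p z := by
      intro z
      by_cases h0 : W (j - z) = 0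
      · have : upMass Y P (c - a * z) (j - z) = 0 :=
          le_antisymm (h0 ▸ upMass_le Y _ _) (upMass_nonneg _ _ _)
        simp [h0, this]
      · field_simp
    have e2 : ∀ z : ℤ, W (j + 1 - z) * p z *
        (strictUpMass Y P (c - a * z) (j + 1 - z) / W (j + 1 - z)) =
        strictUpMass Y P (c - a * z) (j + 1 - z) * p z := by
      intro z
      by_cases h0 : W (j + 1 - z) = 0
      · have : strictUpMass Y P (c - a * z) (j + 1 - z) = 0 :=
          le_antisymm (h0 ▸ strictUpMass_le Y _ _) (strictUpMass_nonneg _ _ _)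
        simp [h0, this]
      · field_simp
    have key := sum_mul_sum_le_of_monotone_ratio
      (fun k => W (j - (m + k)) * p (m + k)) (fun k => W (j + 1 - (m + k)) * p (m + k))
      (fun k => upMass Y P (c - a * (m + k : ℤ)) (j - (m + k)) / W (j - (m + k)))
      (fun k => strictUpMass Y P (c - a * (m + k : ℤ)) (j + 1 - (m + k)) / W (j + 1 - (m + k))) N
      (fun k => mul_nonneg (hW0 _) (hp0 _)) (fun k => mul_nonneg (hW0 _) (hp0 _))
      ?_ ?_ ?_ ?_
    · simpa only [e1, e2] using key
    -- Here `β / α` is `W (j + 1 - z) / W (j - z)`, nondecreasing in `z` by log-concavity of `W`.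
    · intro s t hst
      have := hYm.isPF2.mul_le_mul (j - (m + t)) (j - (m + s)) (by lia)
      rw [← sub_add_eq_add_sub, ← sub_add_eq_add_sub]
      have := mul_le_mul_of_nonneg_left this (mul_nonneg (hp0 (m + s)) (hp0 (m + t)))
      linarith
    -- Here `β (· + 1) / α` is `p (z + 1) / p z`, nonincreasing by log-concavity of `p`.
    · intro s t hst
      have := hlc.mul_le_mul (m + s) (m + t) (by lia)
      push_cast
      rw [show j + 1 - (m + ((t : ℤ) + 1)) = j - (m + t) by ring,
        show j + 1 - (m + ((s : ℤ) + 1)) = j - (m + s) by ring,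
        show m + ((t : ℤ) + 1) = m + t + 1 by ring, show m + ((s : ℤ) + 1) = m + s + 1 by ring]
      have := mul_le_mul_of_nonneg_left this
        (mul_nonneg (hW0 (j - (m + s))) (hW0 (j - (m + t))))
      linarith
    · intro t h1 h2
      have w1 : 0 < W (j - (m + t)) := pos_of_mul_pos_left h1 (hp0 _)
      have w2 : 0 < W (j + 1 - (m + t)) := pos_of_mul_pos_left h2 (hp0 _)
      rw [div_le_div_iff₀ w1 w2, ← sub_add_eq_add_sub]
      exact hYm.le _ _
    · intro t h1 h2
      have w1 : 0 < W (j - (m + t)) := pos_of_mul_pos_left h1 (hp0 _)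
      have e : j + 1 - (m + ((t + 1 : ℕ) : ℤ)) = j - (m + t) := by push_cast; ring
      rw [e]
      -- `X` rises and the old sum stays: the threshold drops by `a > 0`, which turns `≤` into `<`.
      refine div_le_div_of_nonneg_right (upMass_le_strictUpMass ?_ _) w1.le
      push_cast
      linarith

theorem massFn_zero (j : ℤ) :
    massFn (fun ω => ((0 : Ω → ℤ × ℝ) ω).1) P j = if j = 0 then 1 else 0 := by
  by_cases h : j = 0
  · simp [massFn, h]
  · simp [massFn, h, Ne.symm h]

theorem isRankMonotone_zero : IsRankMonotone (0 : Ω → ℤ × ℝ) P := by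
  refine ⟨⟨fun j => massFn_nonneg _ _, fun s t hst => ?_⟩, ?_, fun c j => ?_⟩
  · simp only [massFn_zero]
    split_ifs <;> first | lia | norm_num
  · refine (Set.finite_singleton (0 : ℤ)).subset fun j hj => ?_
    rw [Function.mem_support, massFn_zero] at hj
    simpa using hj
  · by_cases hj : j = -1
    · have : upMass (0 : Ω → ℤ × ℝ) P c j = 0 := by simp [upMass, hj]
      rw [this, zero_mul]
      exact mul_nonneg (strictUpMass_nonneg _ _ _) (massFn_nonneg _ _)
    · have : massFn (fun ω => ((0 : Ω → ℤ × ℝ) ω).1) P (j + 1) = 0 := by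
        rw [massFn_zero, if_neg (by lia)]
      rw [this, mul_zero]
      exact mul_nonneg (strictUpMass_nonneg _ _ _) (massFn_nonneg _ _)

section Sum

variable {ι : Type*} {X : ι → Ω → ℤ} (a : ι → ℝ)

theorem isRankMonotone_sum {a : ι → ℝ} (ha : ∀ i, 0 < a i)
    (hind : iIndepFun X P) (hX : ∀ i, Measurable (X i)) (hlc : ∀ i, IsPF2 (massFn (X i) P))
    (hfin : ∀ i, (Function.support (massFn (X i) P)).Finite) (s : Finset ι) :
    IsRankMonotone (∑ i ∈ s, fun ω => (X i ω, a i * (X i ω : ℝ))) P := by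
  classical
  induction s using Finset.induction_on with
  | empty => simpa using isRankMonotone_zero
  | insert i s hi ih =>
    rw [Finset.sum_insert hi, add_comm]
    exact ih.add (ha i) (indepFun_sum_pair a hind hX hi) (hX i) (measurable_sum_pair a hX s)
      (hlc i) (hfin i)

theorem exists_massFn_sum_symm (hind : iIndepFun X P) (hX : ∀ i, Measurable (X i))
    (hfin : ∀ i, (Function.support (massFn (X i) P)).Finite)
    (hs : ∀ i, ∃ c, ∀ j, massFn (X i) P (c - j) = massFn (X i) P j) (s : Finset ι) :
    ∃ c, ∀ j, massFn (fun ω => ((∑ i ∈ s, fun ω => (X i ω, a i * (X i ω : ℝ))) ω).1) P (c - j) =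
      massFn (fun ω => ((∑ i ∈ s, fun ω => (X i ω, a i * (X i ω : ℝ))) ω).1) P j := by
  classical
  induction s using Finset.induction_on with
  | empty => exact ⟨0, fun j => by simp only [Finset.sum_empty, massFn_zero, zero_sub, neg_eq_zero]⟩
  | insert i s hi ih =>
    rw [Finset.sum_insert hi, add_comm]
    exact exists_massFn_fst_add_symm (indepFun_sum_pair a hind hX hi) (hX i)
      (measurable_sum_pair a hX s) (hfin i) (hs i) ih

end Sum

/-- Every value of the second component has probability at most the height of the mode of the
first one. -/
theorem IsRankMonotone.measureReal_snd_eq_le {Y : Ω → ℤ × ℝ} (h : IsRankMonotone Y P)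
    (hY : Measurable Y) {M : ℝ} (hM : ∀ j, massFn (fun ω => (Y ω).1) P j ≤ M) (x : ℝ) :
    P.real {ω | (Y ω).2 = x} ≤ M := by
  set W := massFn (fun ω => (Y ω).1) P with hW
  set K := h.finite.toFinset with hK
  have hKs : Function.support W ⊆ K := by simp [hK, hW]
  have hM0 : 0 ≤ M := (massFn_nonneg _ 0).trans (hM 0)
  have hsum : P.real {ω | (Y ω).2 = x} = ∑ z ∈ K, (upMass Y P x z - strictUpMass Y P x z) := by
    have hE : MeasurableSet {ω | (Y ω).2 = x} :=
      (measurable_snd.comp hY) (measurableSet_singleton x)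
    rw [measureReal_eq_sum_inter (measurable_fst.comp hY) (X := fun ω => (Y ω).1) hKs hE]
    refine Finset.sum_congr rfl fun z _ => ?_
    rw [eq_sub_iff_add_eq, upMass, strictUpMass, ← measureReal_union]
    · congr 1
      ext ω
      simp only [Set.mem_union, Set.mem_inter_iff, Set.mem_ofPred_eq,
        le_iff_lt_or_eq, eq_comm (a := x)]
      tauto
    · refine Set.disjoint_left.2 ?_
      rintro ω ⟨-, h1⟩ ⟨-, h2⟩
      exact h2.ne' h1
    · exact (measurable_fst.comp hY (measurableSet_singleton z)).inter
        (measurable_snd.comp hY measurableSet_Ioi)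
  rw [hsum]
  rcases K.eq_empty_or_nonempty with h0 | hne
  · simpa [h0] using hM0
  set A := K.min' hne with hA
  set B := K.max' hne with hB
  have hpos : ∀ z ∈ K, 0 < W z := by
    intro z hz
    have : W z ≠ 0 := by simpa [hK] using hz
    exact lt_of_le_of_ne (h.isPF2.nonneg z) this.symm
  have hAB : A ≤ B := K.min'_le_max' hne
  have hpos' : ∀ k : ℕ, k ≤ (B - A).toNat → 0 < W (A + k) := by
    intro k hk
    exact h.isPF2.pos_of_mem (hpos A (K.min'_mem hne)) (hpos B (K.max'_mem hne)) (by lia) (by lia)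
  have hd : ∀ z, 0 ≤ upMass Y P x z - strictUpMass Y P x z := fun z =>
    sub_nonneg.2 (strictUpMass_le_upMass _ _ _)
  calc ∑ z ∈ K, (upMass Y P x z - strictUpMass Y P x z)
      ≤ ∑ z ∈ (Finset.range ((B - A).toNat + 1)).map (natShift A),
          (upMass Y P x z - strictUpMass Y P x z) := by
        refine Finset.sum_le_sum_of_subset_of_nonneg (fun z hz => ?_) fun z _ _ => hd z
        have h1 := K.min'_le z hz
        have h2 := K.le_max' z hz
        simp only [Finset.mem_map, Finset.mem_range, natShift_apply]
        exact ⟨(z - A).toNat, by lia, by lia⟩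
    _ = ∑ k ∈ Finset.range ((B - A).toNat + 1),
          (upMass Y P x (A + k) - strictUpMass Y P x (A + k)) := by
        rw [Finset.sum_map]; rfl
    -- Each term is a conditional probability of `Y₂ = x` times `W ≤ M`; the conditional
    -- probabilities then telescope.
    _ ≤ ∑ k ∈ Finset.range ((B - A).toNat + 1),
          (upMass Y P x (A + k) - strictUpMass Y P x (A + k)) / W (A + k) * M := by
        refine Finset.sum_le_sum fun k hk => ?_
        have w := hpos' k (by have := Finset.mem_range.1 hk; lia)
        rw [div_mul_eq_mul_div, le_div_iff₀ w]
        exact mul_le_mul_of_nonneg_left (hM _) (hd _)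
    _ ≤ 1 * M := by
        rw [← Finset.sum_mul]
        refine mul_le_mul_of_nonneg_right ((h.sum_sub_le x A _ hpos').trans ?_) hM0
        exact div_le_one_of_le₀ (upMass_le _ _ _) (massFn_nonneg _ _)
    _ = M := one_mul M

end Discrete

/-! ### Maximal mass and variance of an integer variable -/

section Variance

variable {Ω : Type*} [MeasurableSpace Ω] {P : Measure Ω} [IsProbabilityMeasure P] {X : Ω → ℤ}

theorem integral_comp_eq_sum (hX : Measurable X) {K : Finset ℤ}
    (hK : Function.support (massFn X P) ⊆ K) (φ : ℤ → ℝ) :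
    ∫ ω, φ (X ω) ∂P = ∑ z ∈ K, massFn X P z * φ z := by
  have hm : ∀ z, MeasurableSet {ω | X ω = z} := fun z => hX (measurableSet_singleton z)
  have hae : (fun ω => φ (X ω)) =ᵐ[P]
      fun ω => ∑ z ∈ K, {ω | X ω = z}.indicator (fun _ => φ z) ω := by
    filter_upwards [ae_mem_of_support_subset hK] with ω hω
    simp [Set.indicator_apply, hω]
  rw [integral_congr_ae hae, integral_finsetSum _ fun z _ => (integrable_const _).indicator (hm z)]
  refine Finset.sum_congr rfl fun z _ => ?_
  rw [integral_indicator_const _ (hm z)]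
  rfl

theorem memLp_of_finite_support (hX : Measurable X)
    (hfin : (Function.support (massFn X P)).Finite) : MemLp (fun ω => (X ω : ℝ)) 2 P := by
  refine MemLp.of_bound (by fun_prop) (∑ z ∈ hfin.toFinset, |(z : ℝ)|) ?_
  filter_upwards [ae_mem_of_support_subset (X := X) (P := P) (K := hfin.toFinset) (by simp)]
    with ω hω
  exact Finset.single_le_sum (f := fun z : ℤ => |(z : ℝ)|) (fun z _ => abs_nonneg _) hω

theorem exists_integral_eq_splitSum (hX : Measurable X)
    (hfin : (Function.support (massFn X P)).Finite) (m : ℤ) :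
    ∃ N : ℕ, massFn X P (m - N) = 0 ∧
      ∀ φ : ℤ → ℝ, ∫ ω, φ (X ω) ∂P = splitSum (massFn X P) φ m N := by
  obtain ⟨A, hA⟩ := hfin.bddBelow
  obtain ⟨B, hB⟩ := hfin.bddAbove
  refine ⟨(m + 1 - A).toNat + (B - m).toNat, ?_, fun φ => ?_⟩
  · by_contra h
    have := hA h
    lia
  set N := (m + 1 - A).toNat + (B - m).toNat with hN
  have inj : Set.InjOn (fun k : ℕ => m - (k : ℤ)) (Finset.range N) := fun _ _ _ _ h => by
    simpa using h
  have hdisj : Disjoint ((Finset.range N).map (natShift (m + 1)))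
      ((Finset.range N).image fun k : ℕ => m - (k : ℤ)) := by
    refine Finset.disjoint_left.2 fun z h1 h2 => ?_
    simp only [Finset.mem_map, Finset.mem_image, natShift_apply] at h1 h2
    obtain ⟨k, -, hk⟩ := h1
    obtain ⟨l, -, hl⟩ := h2
    lia
  rw [integral_comp_eq_sum hX (K := (Finset.range N).map (natShift (m + 1)) ∪
    (Finset.range N).image fun k : ℕ => m - (k : ℤ)), Finset.sum_union hdisj, Finset.sum_map,
    Finset.sum_image inj]
  · rfl
  · intro z hz
    have h1 := hA hz
    have h2 := hB hz
    simp only [Finset.coe_union, Finset.coe_map, Finset.coe_image, Finset.coe_range, Set.mem_union,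
      Set.mem_image, Set.mem_Iio, natShift_apply]
    rcases le_or_gt z m with h | h
    · exact Or.inr ⟨(m - z).toNat, by lia, by lia⟩
    · exact Or.inl ⟨(z - m - 1).toNat, by lia, by lia⟩

theorem exists_massFn_pos_and_le (hX : Measurable X)
    (hfin : (Function.support (massFn X P)).Finite) :
    ∃ m, 0 < massFn X P m ∧ ∀ j, massFn X P j ≤ massFn X P m := by
  have h1 := integral_comp_eq_sum (P := P) hX (K := hfin.toFinset) (by simp) fun _ => (1 : ℝ)
  have hne : hfin.toFinset.Nonempty := by
    rw [Finset.nonempty_iff_ne_empty]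
    intro h
    simp [h] at h1
  obtain ⟨m, hm, hmax⟩ := hfin.toFinset.exists_max_image (massFn X P) hne
  have hm' : 0 < massFn X P m := lt_of_le_of_ne (massFn_nonneg _ _) (Ne.symm (by simpa using hm))
  refine ⟨m, hm', fun j => ?_⟩
  by_cases hj : massFn X P j = 0
  · rw [hj]; exact hm'.le
  · exact hmax j (by simpa using hj)

theorem variance_eq_splitSum (hX : Measurable X) (hfin : (Function.support (massFn X P)).Finite)
    {m : ℤ} {N : ℕ} (hN : ∀ φ : ℤ → ℝ, ∫ ω, φ (X ω) ∂P = splitSum (massFn X P) φ m N) :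
    variance (fun ω => (X ω : ℝ)) P =
      splitSum (massFn X P) (fun j => ((j - m : ℤ) : ℝ) ^ 2) m N -
        splitSum (massFn X P) (fun j => ((j - m : ℤ) : ℝ)) m N ^ 2 := by
  have hL := memLp_of_finite_support hX hfin
  have hL' : MemLp (fun ω => (X ω : ℝ) - m) 2 P := hL.sub (memLp_const (m : ℝ))
  rw [← variance_sub_const hL.aestronglyMeasurable (m : ℝ), variance_eq_sub hL', ← hN, ← hN]
  simp

theorem splitSum_one_eq_one {m : ℤ} {N : ℕ}
    (hN : ∀ φ : ℤ → ℝ, ∫ ω, φ (X ω) ∂P = splitSum (massFn X P) φ m N) :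
    splitSum (massFn X P) 1 m N = 1 := by
  simp [← hN]

theorem IsPF2.exists_sq_mul_one_add_variance_le (hX : Measurable X)
    (hlc : IsPF2 (massFn X P)) (hfin : (Function.support (massFn X P)).Finite) :
    ∃ M, 0 ≤ M ∧ (∀ j, massFn X P j ≤ M) ∧
      M ^ 2 * (1 + variance (fun ω => (X ω : ℝ)) P) ≤ 1 := by
  obtain ⟨m, hm, hmax⟩ := exists_massFn_pos_and_le hX hfin
  obtain ⟨N, h0, hN⟩ := exists_integral_eq_splitSum hX hfin m
  refine ⟨_, hm.le, hmax, ?_⟩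
  rw [variance_eq_splitSum hX hfin hN]
  exact sq_mul_one_add_variance_le hlc m N h0 (splitSum_one_eq_one hN) hm

theorem IsPF2.exists_sq_mul_one_add_two_variance_le (hX : Measurable X)
    (hlc : IsPF2 (massFn X P)) (hfin : (Function.support (massFn X P)).Finite)
    (hs : ∃ c, ∀ j, massFn X P (c - j) = massFn X P j) :
    ∃ M, 0 ≤ M ∧ (∀ j, massFn X P j ≤ M) ∧
      M ^ 2 * (1 + 2 * variance (fun ω => (X ω : ℝ)) P) ≤ 1 := by
  obtain ⟨l, hl, -⟩ := exists_massFn_pos_and_le hX hfin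
  obtain ⟨c, hc⟩ := hs
  -- The centre `c / 2` is an integer or a half-integer; log-concavity puts a mode at `m` in both
  -- cases.
  obtain ⟨m, rfl | rfl⟩ := Int.even_or_odd' c
  · have hmax : ∀ j, massFn X P j ≤ massFn X P m := by
      intro j
      refine le_of_sq_le_sq ?_ (massFn_nonneg _ _)
      rcases le_total j m with h | h
      · have := hlc.outer_le_inner (w := j) (x := m) (y := m) (z := 2 * m - j) h h (by ring)
        rw [hc] at this
        linarith
      · have := hlc.outer_le_inner (w := 2 * m - j) (x := m) (y := m) (z := j) (by lia) (by lia)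
          (by ring)
        rw [hc] at this
        linarith
    have hm := hl.trans_le (hmax l)
    obtain ⟨N, h0, hN⟩ := exists_integral_eq_splitSum hX hfin m
    refine ⟨_, hm.le, hmax, ?_⟩
    rw [variance_eq_splitSum hX hfin hN]
    exact sq_mul_one_add_two_variance_le_of_symm hlc m N h0 (splitSum_one_eq_one hN) hm hc
  · have hm1 : massFn X P (m + 1) = massFn X P m := by rw [← hc]; congr 1; ring
    have hmax : ∀ j, massFn X P j ≤ massFn X P m := by
      intro j
      refine le_of_sq_le_sq ?_ (massFn_nonneg _ _)
      rcases le_or_gt j m with h | h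
      · have := hlc.outer_le_inner (w := j) (x := m) (y := m + 1) (z := 2 * m + 1 - j) h (by lia)
          (by ring)
        rw [hc, hm1] at this
        linarith
      · have := hlc.outer_le_inner (w := 2 * m + 1 - j) (x := m) (y := m + 1) (z := j) (by lia)
          (by lia) (by ring)
        rw [hc, hm1] at this
        linarith
    have hm := hl.trans_le (hmax l)
    obtain ⟨N, -, hN⟩ := exists_integral_eq_splitSum hX hfin m
    refine ⟨_, hm.le, hmax, le_trans ?_ (sq_mul_one_add_two_moment_le_of_symm_half hlc m N
      (splitSum_one_eq_one hN) hm hc)⟩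
    have hL := memLp_of_finite_support hX hfin
    -- An upper bound suffices: the second moment about any point dominates the variance.
    have hv : variance (fun ω => (X ω : ℝ)) P ≤ ∫ ω, ((X ω : ℝ) - m - 1 / 2) ^ 2 ∂P := by
      rw [← variance_sub_const hL.aestronglyMeasurable (m + 1 / 2 : ℝ)]
      refine (variance_le_expectation_sq (by fun_prop)).trans (le_of_eq ?_)
      simp [sub_sub]
    rw [← hN fun j => ((j : ℝ) - m - 1 / 2) ^ 2]
    have := mul_le_mul_of_nonneg_left hv (sq_nonneg (massFn X P m))
    linarith

/-- Twice the centre is an integer: the reflection `2m - l` of an atom `l` is itself a value of `X`.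
-/
theorem IsSymmetricAboutPoint.exists_int (hX : Measurable X)
    (hfin : (Function.support (massFn X P)).Finite) (h : IsSymmetricAboutPoint X P) :
    ∃ c : ℤ, ∀ j, massFn X P (c - j) = massFn X P j := by
  obtain ⟨m, hm⟩ := h
  have key : ∀ j : ℤ, massFn X P j = P.real {ω | (X ω : ℝ) = 2 * m - j} := by
    intro j
    have := hm.measure_mem_eq (measurableSet_singleton ((j : ℝ) - m))
    rw [massFn, measureReal_def, measureReal_def]
    congr 1
    convert this using 2
    · ext ω
      simp
    · ext ω
      simp only [Set.mem_ofPred_eq, Set.mem_preimage, Set.mem_singleton_iff]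
      constructor <;> intro h <;> linarith
  obtain ⟨l, hl, -⟩ := exists_massFn_pos_and_le hX hfin
  rw [key l] at hl
  obtain ⟨ω, hω⟩ : {ω | (X ω : ℝ) = 2 * m - l}.Nonempty := by
    rw [Set.nonempty_iff_ne_empty]
    intro h
    simp [h] at hl
  have hω' : (X ω : ℝ) = 2 * m - l := hω
  refine ⟨X ω + l, fun j => ?_⟩
  rw [key j, massFn]
  congr 1
  ext ω'
  have e : 2 * m - (j : ℝ) = ((X ω + l - j : ℤ) : ℝ) := by push_cast; linarith
  simp only [Set.mem_ofPred_eq, e, Int.cast_inj]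

end Variance

/-! ### Reduction to positive coefficients and conclusion -/

section Reduction

variable {Ω : Type*} [MeasurableSpace Ω] {P : Measure Ω} [IsProbabilityMeasure P]

/-- After changing the signs of the variables with negative coefficients, the concentration of a
linear combination is dominated by that of the sum. -/
theorem exists_sum_dominating {n : ℕ} {X : Fin n → Ω → ℤ} (hX : ∀ k, Measurable (X k))
    (hind : iIndepFun X P) (hlc : ∀ k, IsPF2 (massFn (X k) P))
    (hfin : ∀ k, (Function.support (massFn (X k) P)).Finite) {a : Fin n → ℝ} (ha : ∀ k, a k ≠ 0) :
    ∃ S : Ω → ℤ, Measurable S ∧ IsPF2 (massFn S P) ∧ (Function.support (massFn S P)).Finite ∧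
      variance (fun ω => (S ω : ℝ)) P = ∑ k, variance (fun ω => (X k ω : ℝ)) P ∧
      ((∀ k, ∃ c, ∀ j, massFn (X k) P (c - j) = massFn (X k) P j) →
        ∃ c, ∀ j, massFn S P (c - j) = massFn S P j) ∧
      ∀ M, (∀ j, massFn S P j ≤ M) → ∀ x : ℝ, P.real {ω | ∑ k, a k * (X k ω : ℝ) = x} ≤ M := by
  set X' : Fin n → Ω → ℤ := fun k ω => if a k < 0 then -X k ω else X k ω with hX'
  have hcase : ∀ k, X' k = X k ∨ X' k = fun ω => -X k ω := by
    intro k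
    by_cases h : a k < 0
    · exact Or.inr (by simp [hX', h])
    · exact Or.inl (by simp [hX', h])
  have hXm : ∀ k, Measurable (X' k) := by
    intro k
    rcases hcase k with h | h <;> rw [h]
    exacts [hX k, (hX k).neg]
  have hind' : iIndepFun X' P :=
    hind.comp (fun k z => if a k < 0 then -z else z) fun k => measurable_of_countable _
  have hlc' : ∀ k, IsPF2 (massFn (X' k) P) := by
    intro k
    rcases hcase k with h | h <;> rw [h]
    · exact hlc k
    · rw [funext (massFn_neg (X k))]
      exact (hlc k).comp_neg
  have hfin' : ∀ k, (Function.support (massFn (X' k) P)).Finite := by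
    intro k
    rcases hcase k with h | h <;> rw [h]
    · exact hfin k
    · rw [funext (massFn_neg (X k))]
      exact (hfin k).preimage neg_injective.injOn
  have hvar : ∀ k, variance (fun ω => (X' k ω : ℝ)) P = variance (fun ω => (X k ω : ℝ)) P := by
    intro k
    rcases hcase k with h | h <;> rw [h]
    simp only [Int.cast_neg]
    exact variance_fun_neg
  -- The first component is the dominating sum `S`. It depends on `a` only through its signs, and
  -- its variance not at all.
  set Y := ∑ k, fun ω => (X' k ω, |a k| * (X' k ω : ℝ)) with hY
  have hYm : Measurable Y := measurable_sum_pair _ hXm _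
  have hYr : IsRankMonotone Y P :=
    isRankMonotone_sum (fun k => abs_pos.2 (ha k)) hind' hXm hlc' hfin' _
  refine ⟨fun ω => (Y ω).1, measurable_fst.comp hYm, hYr.isPF2, hYr.finite, ?_, fun hs => ?_,
    fun M hM x => ?_⟩
  · have e : (fun ω => (((Y ω).1 : ℤ) : ℝ)) = ∑ k, fun ω => (X' k ω : ℝ) := by
      ext ω
      simp [hY, Prod.fst_sum]
    rw [e, IndepFun.variance_sum (fun k _ => memLp_of_finite_support (hXm k) (hfin' k))]
    · exact Finset.sum_congr rfl fun k _ => hvar k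
    · intro i _ j _ hij
      exact (hind'.indepFun hij).comp (φ := fun z : ℤ => (z : ℝ)) (ψ := fun z : ℤ => (z : ℝ))
        (measurable_of_countable _) (measurable_of_countable _)
  · refine exists_massFn_sum_symm _ hind' hXm hfin' (fun k => ?_) _
    obtain ⟨c, hc⟩ := hs k
    rcases hcase k with h | h <;> rw [h]
    · exact ⟨c, hc⟩
    · refine ⟨-c, fun j => ?_⟩
      rw [massFn_neg, massFn_neg, ← hc (-j)]
      congr 1
      ring
  · have e : ∀ ω, ∑ k, a k * (X k ω : ℝ) = (Y ω).2 := by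
      intro ω
      have e' : (Y ω).2 = ∑ k, |a k| * (X' k ω : ℝ) := by simp [hY, Prod.snd_sum]
      rw [e']
      refine Finset.sum_congr rfl fun k _ => ?_
      by_cases h : a k < 0
      · simp [hX', h, abs_of_neg h]
      · simp [hX', h, abs_of_nonneg (not_lt.1 h)]
    simp only [e]
    exact hYr.measureReal_snd_eq_le hYm hM x

theorem le_one_div_sqrt_of_sq_mul_le_one {M v : ℝ} (hM : 0 ≤ M) (hv : 0 < v)
    (h : M ^ 2 * v ≤ 1) : M ≤ 1 / Real.sqrt v := by
  rw [le_div_iff₀ (Real.sqrt_pos.2 hv), ← Real.sqrt_sq hM, ← Real.sqrt_mul (sq_nonneg M)]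
  exact Real.sqrt_le_one.2 h

theorem iSup_measure_le {n : ℕ} {X : Fin n → Ω → ℤ} {v : ℝ} (hv : 0 < v)
    (h : ∀ a : Fin n → ℝ, (∀ k, a k ≠ 0) → ∃ M, 0 ≤ M ∧ M ^ 2 * v ≤ 1 ∧
      ∀ x : ℝ, P.real {ω | ∑ k, a k * (X k ω : ℝ) = x} ≤ M) :
    (⨆ (a : Fin n → ℝ) (_ : ∀ k, a k ≠ 0) (x : ℝ), P {ω | ∑ k, a k * (X k ω : ℝ) = x}) ≤
      ENNReal.ofReal (1 / Real.sqrt v) := by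
  refine iSup_le fun a => iSup_le fun ha => iSup_le fun x => ?_
  obtain ⟨M, h0, h1, h2⟩ := h a ha
  rw [← ofReal_measureReal]
  exact ENNReal.ofReal_le_ofReal ((h2 x).trans (le_one_div_sqrt_of_sq_mul_le_one h0 hv h1))

end Reduction

theorem theorem1p1 {Ω : Type*} [MeasurableSpace Ω] (P : Measure Ω) [IsProbabilityMeasure P]
    (n : ℕ) (hn : 1 ≤ n) (X : Fin n → Ω → ℤ)
    (hmeas : ∀ k, Measurable (X k))
    (hindep : iIndepFun X P)
    (hlc : ∀ k, IsDiscreteLogConcave (X k) P)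
    (hfin : ∀ k, IsFinitelySupported (X k) P) :
    ((⨆ (a : Fin n → ℝ) (_ : ∀ k, a k ≠ 0) (x : ℝ), P {ω | ∑ k, a k * (X k ω : ℝ) = x}) ≤
      ENNReal.ofReal
        (1 / Real.sqrt (1 + ∑ k, variance (fun ω => (X k ω : ℝ)) P))) ∧
    ((∀ k, IsSymmetricAboutPoint (X k) P) →
      (⨆ (a : Fin n → ℝ) (_ : ∀ k, a k ≠ 0) (x : ℝ), P {ω | ∑ k, a k * (X k ω : ℝ) = x}) ≤
        ENNReal.ofReal
          (1 / Real.sqrt (1 + 2 * ∑ k, variance (fun ω => (X k ω : ℝ)) P))) := by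
  have hvar : 0 ≤ ∑ k, variance (fun ω => (X k ω : ℝ)) P :=
    Finset.sum_nonneg fun k _ => variance_nonneg _ _
  refine ⟨iSup_measure_le (by linarith) fun a ha => ?_,
    fun hs => iSup_measure_le (by linarith) fun a ha => ?_⟩
  · obtain ⟨S, hS, hSlc, hSfin, hSvar, -, hdom⟩ :=
      exists_sum_dominating hmeas hindep (fun k => (hlc k).isPF2) hfin ha
    obtain ⟨M, h0, hM, h1⟩ := hSlc.exists_sq_mul_one_add_variance_le hS hSfin
    rw [hSvar] at h1
    exact ⟨M, h0, h1, hdom M hM⟩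
  · obtain ⟨S, hS, hSlc, hSfin, hSvar, hsym, hdom⟩ :=
      exists_sum_dominating hmeas hindep (fun k => (hlc k).isPF2) hfin ha
    obtain ⟨M, h0, hM, h1⟩ := hSlc.exists_sq_mul_one_add_two_variance_le hS hSfin
      (hsym fun k => (hs k).exists_int (hmeas k) (hfin k))
    rw [hSvar] at h1
    exact ⟨M, h0, h1, hdom M hM⟩
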